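/- Let $k$ be a field and let $n\ge 1$. Let $A$ be the path algebra over $k$ of the quiver $1\to 2\to\dots\to n$, with the product given by concatenation of paths. Let $\mathcal{A}_n$ be the abelian category of finite-dimensional right $A$-modules, and let $D\mathcal{A}_n$ be its bounded derived category. Let $N_n$ be the standard $A$-bimodule with support $\{(i,j)\in[1,n]\times[1,n] : i\ge j\}$: its component $e_iN_ne_j$ is a copy of $k$ if $i\ge j$ and is zero otherwise, and every path acts by the identity of $k$ between two nonzero components (for the left action, a path $i\to l$ maps $e_lN_ne_j$ to $e_iN_ne_j$; for the right action, a path $l\to j$ maps $e_iN_ne_l$ to $e_iN_ne_j$). Let $\nu_n : D\mathcal{A}_n\to D\mathcal{A}_n$ be the Nakayama functor, that is, the total left derived functor of $\operatorname{Hom}_k(\operatorname{Hom}_A(-,A),k):\mathcal{A}_n\to\mathcal{A}_n$. Then the total left derived functors $\nu_n$ and $-\otimes^{L}_{A}N_n$ exist on $D\mathcal{A}_n$, and they are isomorphic: $\nu_n\cong -\otimes^{L}_{A}N_n$ as functors $D\mathcal{A}_n\to D\mathcal{A}_n$. -/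

import Mathlib

universe w u

section BoundedDerivedCategory

open CategoryTheory Limits ZeroObject Pretriangulated HomotopicalAlgebra

namespace BoundedDerived

variable (C : Type*) [Category* C]

/-- The property of being a (strictly) bounded cochain complex. -/
def bounded [HasZeroMorphisms C] : ObjectProperty (CochainComplex C ℤ) :=
  fun K => (∃ a : ℤ, K.IsStrictlyGE a) ∧ ∃ b : ℤ, K.IsStrictlyLE b

/-- The category `Cᵇ(C)` of bounded cochain complexes in `C`. -/
abbrev Complexes [HasZeroMorphisms C] := (bounded C).FullSubcategory

/-- Quasi-isomorphisms in `Cᵇ(C)`. -/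
def quasiIso [Abelian C] : MorphismProperty (Complexes C) :=
  (HomologicalComplex.quasiIso C (ComplexShape.up ℤ)).inverseImage (bounded C).ι

section

variable [Abelian C]

/-- Bounded complexes, in the homotopy category of bounded below complexes. -/
def homotopyBounded : ObjectProperty (HomotopyCategory.Plus C) :=
  fun K => ∃ b : ℤ, CochainComplex.IsStrictlyLE (K.obj.as) b

/-- The homotopy category `Kᵇ(C)`. -/
abbrev Homotopy := (homotopyBounded C).FullSubcategory

instance : (homotopyBounded C).ContainsZero where
  exists_zero := by
    refine ⟨⟨(HomotopyCategory.quotient _ _).obj 0, ?_⟩, ?_, ?_⟩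
    · rw [HomotopyCategory.plus_quotient_obj_iff]
      exact ⟨0, inferInstance⟩
    · rw [IsZero.iff_id_eq_zero]
      ext
      exact (Functor.map_isZero (HomotopyCategory.quotient C (.up ℤ)) (isZero_zero _)).eq_of_src _ _
    · exact ⟨0, inferInstanceAs (CochainComplex.IsStrictlyLE (0 : CochainComplex C ℤ) 0)⟩

instance : (homotopyBounded C).IsStableUnderShift ℤ where
  isStableUnderShiftBy n :=
    { le_shift K hK := by
        obtain ⟨q, _⟩ := hK
        have h := CochainComplex.isStrictlyLE_shift K.obj.as q n (q - n) (by lia)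
        refine ⟨q - n, ?_⟩
        have e₁ : (K⟦n⟧).obj = (K.obj)⟦n⟧ := by with_unfolding_all rfl
        have e₂ : ((K.obj)⟦n⟧).as = (K.obj.as)⟦n⟧ := by with_unfolding_all rfl
        rw [e₁, e₂]
        exact h }

lemma isStrictlyLE_mappingCone {K L : CochainComplex C ℤ} (f : K ⟶ L)
    (n₁ n₂ : ℤ) [K.IsStrictlyLE n₁] [L.IsStrictlyLE n₂] :
    (CochainComplex.mappingCone f).IsStrictlyLE (max n₁ n₂) := by
  rw [CochainComplex.isStrictlyLE_iff]
  intro i hi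
  simp only [CochainComplex.mappingCone.isZero_X_iff]
  exact ⟨K.isZero_of_isStrictlyLE n₁ _ (by grind), L.isZero_of_isStrictlyLE n₂ _ (by grind)⟩

instance : (homotopyBounded C).IsTriangulatedClosed₃ where
  ext₃' T hT h₁ h₂ := by
    obtain ⟨n₁, _⟩ := h₁
    obtain ⟨n₂, _⟩ := h₂
    obtain ⟨m₁, _⟩ : (CochainComplex.plus C) T.obj₁.obj.as := by
      rw [← HomotopyCategory.plus_quotient_obj_iff]; exact T.obj₁.property
    obtain ⟨m₂, _⟩ : (CochainComplex.plus C) T.obj₂.obj.as := by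
      rw [← HomotopyCategory.plus_quotient_obj_iff]; exact T.obj₂.property
    obtain ⟨f : T.obj₁.obj.as ⟶ T.obj₂.obj.as, hf⟩ :=
      (HomotopyCategory.quotient _ _).map_surjective T.mor₁.hom
    have hp : (HomotopyCategory.plus C) ((HomotopyCategory.quotient _ _).obj
        (CochainComplex.mappingCone f)) := by
      rw [HomotopyCategory.plus_quotient_obj_iff]
      exact ⟨min (m₁ - 1) m₂, CochainComplex.isStrictlyGE_mappingCone f m₁ m₂ _
        (by simp) (by simp)⟩
    have hT' := (HomotopyCategory.Plus.ι C).map_distinguished _ hT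
    refine ⟨⟨_, hp⟩, ⟨_, isStrictlyLE_mappingCone C f n₁ n₂⟩, ⟨?_⟩⟩
    refine (HomotopyCategory.Plus.ι C).preimageIso (Triangle.π₃.mapIso
      (isoTriangleOfIso₁₂ _ _ hT'
        (HomotopyCategory.mappingCone_triangleh_distinguished f)
        (Iso.refl _) (Iso.refl _) ?_))
    change T.mor₁.hom ≫ 𝟙 _ = 𝟙 _ ≫ (HomotopyCategory.quotient _ _).map f
    rw [hf]
    exact (Category.comp_id _).trans (Category.id_comp _).symm

instance : (homotopyBounded C).IsTriangulated where
  toIsTriangulatedClosed₂ := .of_isTriangulatedClosed₃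

instance : (homotopyBounded C).IsVerdierLeftLocalizing
    (HomotopyCategory.Plus.subcategoryAcyclic C) where
  fac {K L} φ hK hL := by
    obtain ⟨b, hb⟩ := hK
    obtain ⟨f : K.obj.as ⟶ L.obj.as, hf⟩ :=
      (HomotopyCategory.quotient _ _).map_surjective φ.hom
    obtain ⟨m, _⟩ : (CochainComplex.plus C) L.obj.as := by
      rw [← HomotopyCategory.plus_quotient_obj_iff]; exact L.property
    have hL' : HomologicalComplex.Acyclic L.obj.as :=
      (HomotopyCategory.quotient_obj_mem_subcategoryAcyclic_iff_acyclic L.obj.as).1 hL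
    have hp : (HomotopyCategory.plus C) ((HomotopyCategory.quotient _ _).obj
        (CochainComplex.truncLE L.obj.as b)) := by
      rw [HomotopyCategory.plus_quotient_obj_iff]
      exact ⟨m, inferInstance⟩
    refine ⟨⟨_, hp⟩, ObjectProperty.homMk ((HomotopyCategory.quotient _ _).map
      (inv (CochainComplex.ιTruncLE K.obj.as b) ≫ CochainComplex.truncLEMap f b)),
      ObjectProperty.homMk ((HomotopyCategory.quotient _ _).map
      (CochainComplex.ιTruncLE L.obj.as b)), ⟨b, ?_⟩, ?_, ?_⟩
    · change (CochainComplex.truncLE L.obj.as b).IsStrictlyLE b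
      infer_instance
    · change HomotopyCategory.subcategoryAcyclic C _
      dsimp
      rw [HomotopyCategory.quotient_obj_mem_subcategoryAcyclic_iff_acyclic]
      exact hL'.truncLE _
    · ext
      change (HomotopyCategory.quotient _ _).map _ ≫ (HomotopyCategory.quotient _ _).map _ = _
      rw [← Functor.map_comp, Category.assoc, CochainComplex.ιTruncLE_naturality,
        IsIso.inv_hom_id_assoc, hf]

/-- The canonical functor `Cᵇ(C) ⥤ Kᵇ(C)`. -/
def quotient : Complexes C ⥤ Homotopy C :=
  (homotopyBounded C).lift ((HomotopyCategory.plus C).lift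
    ((bounded C).ι ⋙ HomotopyCategory.quotient C (.up ℤ))
      (fun K => (HomotopyCategory.plus_quotient_obj_iff _).2 K.property.1))
    (fun K => K.property.2)

instance : (quotient C).EssSurj where
  mem_essImage K := by
    refine ⟨⟨K.obj.obj.as, ?_, K.property⟩, ⟨Iso.refl _⟩⟩
    exact (HomotopyCategory.plus_quotient_obj_iff K.obj.obj.as).1 K.obj.property

instance : (quotient C).Full where
  map_surjective {K L} f := by
    obtain ⟨g, hg⟩ := (HomotopyCategory.quotient C (.up ℤ)).map_surjective f.hom.hom
    refine ⟨ObjectProperty.homMk g, ?_⟩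
    ext
    exact hg

lemma bounded_cylinder (K : CochainComplex C ℤ) (hK : bounded C K) :
    bounded C (HomologicalComplex.cylinder K) := by
  refine ⟨CochainComplex.plus_cylinder K hK.1, ?_⟩
  obtain ⟨n, hn⟩ := hK.2
  refine ⟨n, ?_⟩
  rw [CochainComplex.isStrictlyLE_iff]
  intro i hi
  dsimp [HomologicalComplex.cylinder]
  refine HomologicalComplex.homotopyCofiber.isZero_X _ _ ?_ (fun j hj ↦ ?_)
  · refine IsZero.of_iso ?_ ((HomologicalComplex.eval C (.up ℤ) i).mapBiprod _ _)
    simpa using K.isZero_of_isStrictlyLE n i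
  · simp only [ComplexShape.up_Rel] at hj
    exact K.isZero_of_isStrictlyLE n _ (by lia)

instance : (quotient C).IsLocalization
    ((HomologicalComplex.homotopyEquivalences C (.up ℤ)).inverseImage (bounded C).ι) :=
  Functor.isLocalization_of_essSurj_of_full_of_exists_cylinders _ _
    (fun K L f hf ↦ by
      have : IsIso ((HomotopyCategory.quotient C (.up ℤ)).map f.hom) := by
        rw [HomologicalComplex.isIso_quotient_map_iff_homotopyEquivalences]
        exact hf
      have : IsIso ((homotopyBounded C).ι.map ((quotient C).map f)) := by
        have : IsIso ((HomotopyCategory.Plus.ι C).map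
          ((homotopyBounded C).ι.map ((quotient C).map f))) := this
        exact isIso_of_reflects_iso _ (HomotopyCategory.Plus.ι C)
      exact isIso_of_reflects_iso _ (homotopyBounded C).ι) (by
    rintro K L f₀ f₁ hf
    obtain ⟨f₀, rfl⟩ := ObjectProperty.homMk_surjective f₀
    obtain ⟨f₁, rfl⟩ := ObjectProperty.homMk_surjective f₁
    replace hf := HomotopyCategory.homotopyOfEq f₀ f₁
      (((homotopyBounded C).ι ⋙ HomotopyCategory.Plus.ι _).congr_map hf)
    exact ⟨K.obj.precylinder.toFullSubcategory (bounded_cylinder C K.obj K.property),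
      Precylinder.LeftHomotopy.fullSubcategoryEquiv.symm
        { h := HomologicalComplex.cylinder.desc _ _ hf
          h₀ := HomologicalComplex.cylinder.ι₀_desc _ _ hf
          h₁ := HomologicalComplex.cylinder.ι₁_desc _ _ hf },
      ⟨HomologicalComplex.cylinder.homotopyEquiv _ (fun n ↦ ⟨n - 1, by simp⟩), rfl⟩⟩)

variable [HasDerivedCategory.{w} C]

/-- The canonical functor `Kᵇ(C) ⥤ Dᵇ(C)`. -/
noncomputable def Qh : Homotopy C ⥤ DerivedCategory.Bounded C :=
  DerivedCategory.TStructure.t.bounded.lift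
    ((homotopyBounded C).ι ⋙ DerivedCategory.Plus.Qh ⋙ DerivedCategory.Plus.ι) (fun K => by
      refine ⟨(DerivedCategory.Plus.Qh.obj K.obj).property, ?_⟩
      obtain ⟨b, hb⟩ := K.property
      refine ⟨b, ?_⟩
      exact inferInstanceAs ((DerivedCategory.Q.obj (K.obj.obj.as : CochainComplex C ℤ)).IsLE b))

/-- The canonical functor `Cᵇ(C) ⥤ Dᵇ(C)` to Mathlib's bounded derived category, sending a bounded
complex to its image in the derived category. -/
noncomputable def Q : Complexes C ⥤ DerivedCategory.Bounded C :=
  DerivedCategory.TStructure.t.bounded.lift ((bounded C).ι ⋙ DerivedCategory.Q) (fun K => by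
    obtain ⟨⟨a, ha⟩, ⟨b, hb⟩⟩ := K.property
    exact ⟨⟨a, inferInstanceAs ((DerivedCategory.Q.obj K.obj).IsGE a)⟩,
      ⟨b, inferInstanceAs ((DerivedCategory.Q.obj K.obj).IsLE b)⟩⟩)

/-- The composition `Cᵇ(C) ⥤ Kᵇ(C) ⥤ Dᵇ(C)`. -/
noncomputable def quotientCompQhIso : quotient C ⋙ Qh C ≅ Q C :=
  (DerivedCategory.TStructure.t.bounded.fullyFaithfulι.whiskeringRight _).preimageIso
    (Functor.isoWhiskerLeft (bounded C).ι (DerivedCategory.quotientCompQhIso C))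

instance : (Qh C).EssSurj where
  mem_essImage X := by
    obtain ⟨⟨a, _⟩, ⟨b, _⟩⟩ := X.property
    have : X.obj.IsGE a := by assumption
    have : X.obj.IsLE b := by assumption
    obtain ⟨K, hK₁, hK₂, ⟨e⟩⟩ := X.obj.exists_iso_Q_obj_of_isGE_of_isLE a b
    refine ⟨(quotient C).obj ⟨K, ⟨a, hK₁⟩, ⟨b, hK₂⟩⟩, ⟨DerivedCategory.TStructure.t.bounded.ι.preimageIso ?_⟩⟩
    exact (DerivedCategory.quotientCompQhIso C).app K ≪≫ e.symm

lemma isIso_Q_map_iff {K L : Complexes C} (f : K ⟶ L) :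
    IsIso ((Q C).map f) ↔ quasiIso C f := by
  rw [← isIso_iff_of_reflects_iso _ DerivedCategory.TStructure.t.bounded.ι]
  exact DerivedCategory.isIso_Q_map_iff_quasiIso C f.hom

instance : (Qh C).IsLocalization
    ((HomotopyCategory.Plus.subcategoryAcyclic C).inverseImage (homotopyBounded C).ι).trW :=
  have h : (DerivedCategory.TStructure.t (C := C)).bounded ≤
    DerivedCategory.TStructure.t.plus := inf_le_left
  have := (ObjectProperty.fullyFaithfulιOfLE h).full
  have := (ObjectProperty.fullyFaithfulιOfLE h).faithful
  ((homotopyBounded C).triangulatedLocalizerMorphism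
    (HomotopyCategory.Plus.subcategoryAcyclic C)).isLocalization_of_isLocalizedFullyFaithful
      (L₂ := DerivedCategory.Plus.Qh) (F := ObjectProperty.ιOfLE h) (Iso.refl _)

/-- The functor `Q : Cᵇ(C) ⥤ Dᵇ(C)` exhibits `Dᵇ(C)` as the localization of `Cᵇ(C)` with respect
to quasi-isomorphisms. -/
instance : (Q C).IsLocalization (quasiIso C) := by
  have : (quotient C ⋙ Qh C).IsLocalization (quasiIso C) := by
    refine Functor.IsLocalization.comp (quotient C) (Qh C)
      ((HomologicalComplex.homotopyEquivalences C (.up ℤ)).inverseImage (bounded C).ι)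
      ((HomotopyCategory.Plus.subcategoryAcyclic C).inverseImage (homotopyBounded C).ι).trW
      _ ?_ ?_ ?_
    · intro K L f hf
      rw [NatIso.isIso_map_iff (quotientCompQhIso C) f, isIso_Q_map_iff]
      exact hf
    · intro K L f hf
      exact homotopyEquivalences_le_quasiIso C (.up ℤ) _ hf
    · intro K L f hf
      let K₀ : Complexes C := ⟨K.obj.obj.as,
        (HomotopyCategory.plus_quotient_obj_iff K.obj.obj.as).1 K.obj.property, K.property⟩
      let L₀ : Complexes C := ⟨L.obj.obj.as,
        (HomotopyCategory.plus_quotient_obj_iff L.obj.obj.as).1 L.obj.property, L.property⟩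
      obtain ⟨g, rfl⟩ := (quotient C).map_surjective (X := K₀) (Y := L₀) f
      refine MorphismProperty.map_mem_map _ _ _ ?_
      rw [← isIso_Q_map_iff, ← NatIso.isIso_map_iff (quotientCompQhIso C)]
      exact Localization.inverts (Qh C) _ _ hf
  exact Functor.IsLocalization.of_iso _ (quotientCompQhIso C)

end

section LeftDerived

variable {C} {D : Type*} [Category* D] [Abelian C] [Abelian D] (F : C ⥤ D) [F.Additive]

/-- The functor `Cᵇ(C) ⥤ Cᵇ(D)` which applies an additive functor `F : C ⥤ D` degreewise. -/
def mapComplexes : Complexes C ⥤ Complexes D :=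
  (bounded D).lift ((bounded C).ι ⋙ F.mapHomologicalComplex (ComplexShape.up ℤ)) (fun K => by
    obtain ⟨⟨a, ha⟩, ⟨b, hb⟩⟩ := K.property
    exact ⟨⟨a, inferInstanceAs (CochainComplex.IsStrictlyGE
        ((F.mapHomologicalComplex (ComplexShape.up ℤ)).obj K.obj) a)⟩,
      ⟨b, inferInstanceAs (CochainComplex.IsStrictlyLE
        ((F.mapHomologicalComplex (ComplexShape.up ℤ)).obj K.obj) b)⟩⟩)

variable [HasDerivedCategory.{w} D]

/-- The additive functor `F : C ⥤ D` has a total left derived functor on bounded derived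
categories: the composite `Cᵇ(C) ⥤ Cᵇ(D) ⥤ Dᵇ(D)` has a left derived functor (a right Kan
extension) with respect to the quasi-isomorphisms of `Cᵇ(C)`. -/
abbrev HasLeftDerived : Prop :=
  (mapComplexes F ⋙ Q D).HasLeftDerivedFunctor (quasiIso C)

variable [HasDerivedCategory.{w} C]

/-- The total left derived functor `Dᵇ(C) ⥤ Dᵇ(D)` of an additive functor `F : C ⥤ D`. -/
noncomputable def leftDerived [HasLeftDerived F] :
    DerivedCategory.Bounded C ⥤ DerivedCategory.Bounded D :=
  (mapComplexes F ⋙ Q D).totalLeftDerived (Q C) (quasiIso C)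

end LeftDerived

end BoundedDerived

end BoundedDerivedCategory

namespace TypeAQuiver

open CategoryTheory
open scoped TensorProduct

section Tensor

variable {A : Type u} [Ring A]
variable (M M' M'' : Type u) [AddCommGroup M] [Module Aᵐᵒᵖ M] [AddCommGroup M'] [Module Aᵐᵒᵖ M']
  [AddCommGroup M''] [Module Aᵐᵒᵖ M'']
variable (N : Type u) [AddCommGroup N] [Module A N] [Module Aᵐᵒᵖ N] 

variable (A) in
/-- The relations `(m · a) ⊗ ν = m ⊗ (a · ν)` which define `M ⊗_A N`, for a right `A`-module `M` and an
`A`-bimodule `N` (a right `A`-module is a module over `Aᵐᵒᵖ`). The two factors are written in the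
order `N ⊗[ℤ] M` because Mathlib lets scalars act on a tensor product through its left factor: in this
way `N ⊗[ℤ] M` is a right `A`-module through the right action of `A` on `N`. -/
def balancedRelations : Submodule Aᵐᵒᵖ (N ⊗[ℤ] M) :=
  Submodule.span Aᵐᵒᵖ {x | ∃ (m : M) (a : A) (ν : N),
    x = ν ⊗ₜ[ℤ] (MulOpposite.op a • m) - (a • ν) ⊗ₜ[ℤ] m}

variable (A) in
/-- The tensor product `M ⊗_A N` of a right `A`-module `M` and an `A`-bimodule `N`, as a right
`A`-module. -/
abbrev BalancedTensor : Type u := (N ⊗[ℤ] M) ⧸ balancedRelations A M N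

variable {M M'} in
/-- The map `M ⊗_A N → M' ⊗_A N` induced by a map `f : M → M'` of right `A`-modules. -/
def BalancedTensor.map (f : M →ₗ[Aᵐᵒᵖ] M') : BalancedTensor A M N →ₗ[Aᵐᵒᵖ] BalancedTensor A M' N :=
  Submodule.mapQ _ _ (TensorProduct.AlgebraTensorModule.lTensor Aᵐᵒᵖ N (f.restrictScalars ℤ)) (by
    refine Submodule.span_le.2 ?_
    rintro _ ⟨m, a, ν, rfl⟩
    refine Submodule.subset_span ⟨f m, a, ν, ?_⟩
    simp [map_smul])

end Tensor

namespace BalancedTensor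

variable {A : Type u} [Ring A]
variable {M M' M'' : Type u} [AddCommGroup M] [Module Aᵐᵒᵖ M] [AddCommGroup M'] [Module Aᵐᵒᵖ M']
  [AddCommGroup M''] [Module Aᵐᵒᵖ M'']
variable {N : Type u} [AddCommGroup N] [Module A N] [Module Aᵐᵒᵖ N]

/-- The class of `m ⊗ ν` in `M ⊗_A N`. -/
def tmul (m : M) (ν : N) : BalancedTensor A M N :=
  Submodule.Quotient.mk (ν ⊗ₜ[ℤ] m)

lemma tmul_add (m : M) (ν ν' : N) : (tmul m (ν + ν') : BalancedTensor A M N) = tmul m ν + tmul m ν' := by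
  simp [tmul, TensorProduct.add_tmul]

lemma add_tmul (m m' : M) (ν : N) : (tmul (m + m') ν : BalancedTensor A M N) = tmul m ν + tmul m' ν := by
  simp [tmul, TensorProduct.tmul_add]

lemma tmul_zero (m : M) : (tmul m (0 : N) : BalancedTensor A M N) = 0 := by simp [tmul]

lemma zero_tmul (ν : N) : (tmul (0 : M) ν : BalancedTensor A M N) = 0 := by simp [tmul]

lemma op_smul_tmul (m : M) (a : A) (ν : N) :
    (tmul (MulOpposite.op a • m) ν : BalancedTensor A M N) = tmul m (a • ν) := by
  refine (Submodule.Quotient.eq _).2 (Submodule.subset_span ⟨m, a, ν, rfl⟩)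

lemma tmul_op_smul (m : M) (a : A) (ν : N) :
    (tmul m (MulOpposite.op a • ν) : BalancedTensor A M N) = MulOpposite.op a • tmul m ν := rfl

@[simp]
lemma map_tmul (f : M →ₗ[Aᵐᵒᵖ] M') (m : M) (ν : N) :
    map N f (tmul m ν : BalancedTensor A M N) = tmul (f m) ν := rfl

lemma span_tmul : Submodule.span Aᵐᵒᵖ {x : BalancedTensor A M N | ∃ m ν, x = tmul m ν} = ⊤ := by
  rw [eq_top_iff]
  rintro x -
  obtain ⟨y, rfl⟩ := Submodule.Quotient.mk_surjective _ x
  induction y using TensorProduct.induction_on with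
  | zero => exact zero_mem _
  | tmul ν m => exact Submodule.subset_span ⟨m, ν, rfl⟩
  | add a b ha hb => exact add_mem ha hb

lemma hom_ext {P : Type u} [AddCommGroup P] [Module Aᵐᵒᵖ P] {f g : BalancedTensor A M N →ₗ[Aᵐᵒᵖ] P}
    (h : ∀ m ν, f (tmul m ν) = g (tmul m ν)) : f = g := by
  refine LinearMap.ext_on span_tmul ?_
  rintro _ ⟨m, ν, rfl⟩
  exact h m ν

instance [Module.Finite Aᵐᵒᵖ M] [Module.Finite Aᵐᵒᵖ N] :
    Module.Finite Aᵐᵒᵖ (BalancedTensor A M N) := by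
  classical
  obtain ⟨s, hs⟩ := Module.Finite.fg_top (R := Aᵐᵒᵖ) (M := M)
  obtain ⟨t, ht⟩ := Module.Finite.fg_top (R := Aᵐᵒᵖ) (M := N)
  refine ⟨⟨Finset.image₂ tmul s t, ?_⟩⟩
  rw [eq_top_iff, ← span_tmul, Submodule.span_le]
  rintro _ ⟨m, ν, rfl⟩
  have hm : m ∈ Submodule.span Aᵐᵒᵖ (s : Set M) := hs ▸ Submodule.mem_top
  have key : tmul m ν ∈ Submodule.span Aᵐᵒᵖ
      (SetLike.coe (Finset.image₂ (tmul (A := A) (M := M) (N := N)) s t)) := ?_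
  · exact key
  induction hm using Submodule.span_induction generalizing ν with
  | zero => rw [zero_tmul]; exact zero_mem _
  | add x y _ _ hx hy => rw [add_tmul]; exact add_mem (hx ν) (hy ν)
  | smul a x _ hx =>
    rw [← MulOpposite.op_unop a, op_smul_tmul]
    exact hx _
  | mem x hx =>
    have hν : ν ∈ Submodule.span Aᵐᵒᵖ (t : Set N) := ht ▸ Submodule.mem_top
    induction hν using Submodule.span_induction with
    | zero => rw [tmul_zero]; exact zero_mem _
    | add y z _ _ hy hz => rw [tmul_add]; exact add_mem hy hz
    | smul a y _ hy =>
      rw [← MulOpposite.op_unop a, tmul_op_smul]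
      exact Submodule.smul_mem _ _ hy
    | mem y hy =>
      exact Submodule.subset_span (Finset.mem_image₂_of_mem hx hy)

end BalancedTensor

section

variable (A : Type u) [Ring A] (N : Type u) [AddCommGroup N] [Module A N] [Module Aᵐᵒᵖ N]
  [SMulCommClass A Aᵐᵒᵖ N] [Module.Finite Aᵐᵒᵖ N]

/-- The functor `- ⊗_A N` on finitely generated right `A`-modules, for an `A`-bimodule `N` which is
finitely generated on the right. -/
noncomputable def tensorFunctor : FGModuleCat.{u} Aᵐᵒᵖ ⥤ FGModuleCat.{u} Aᵐᵒᵖ where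
  obj M := FGModuleCat.of Aᵐᵒᵖ (BalancedTensor A M N)
  map f := FGModuleCat.ofHom (BalancedTensor.map N f.hom.hom)
  map_id M := by
    apply FGModuleCat.hom_ext
    exact BalancedTensor.hom_ext (fun _ _ => rfl)
  map_comp f g := by
    apply FGModuleCat.hom_ext
    exact BalancedTensor.hom_ext (fun _ _ => rfl)

instance : (tensorFunctor A N).Additive where
  map_add {M M' f g} := by
    apply FGModuleCat.hom_ext
    refine BalancedTensor.hom_ext (fun m ν => ?_)
    exact BalancedTensor.add_tmul (f.hom.hom m) (g.hom.hom m) ν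

end

section

variable (k : Type u) [Field k] (A : Type u) [Ring A] [Algebra k A]

/-- The underlying space of the right `A`-module `D Hom_A(M, A)`, where `M` is a right `A`-module and
`D = Hom_k(-, k)`. -/
def NakayamaModule (M : Type u) [AddCommGroup M] [Module Aᵐᵒᵖ M] : Type u :=
  Module.Dual k (M →ₗ[Aᵐᵒᵖ] A)

namespace NakayamaModule

variable {k A}
variable {M M' M'' : Type u} [AddCommGroup M] [Module Aᵐᵒᵖ M] [AddCommGroup M'] [Module Aᵐᵒᵖ M']
  [AddCommGroup M''] [Module Aᵐᵒᵖ M'']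

noncomputable instance : AddCommGroup (NakayamaModule k A M) :=
  inferInstanceAs (AddCommGroup (Module.Dual k (M →ₗ[Aᵐᵒᵖ] A)))

noncomputable instance : Module k (NakayamaModule k A M) :=
  inferInstanceAs (Module k (Module.Dual k (M →ₗ[Aᵐᵒᵖ] A)))

/-- An element of `D Hom_A(M, A)`, viewed as a linear form on `Hom_A(M, A)`. -/
def form (ξ : NakayamaModule k A M) : (M →ₗ[Aᵐᵒᵖ] A) →ₗ[k] k := ξ

/-- The right action of `A` on `D Hom_A(M, A)`: it is given by `(ξ · a) φ = ξ (a φ)`, where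
`(a φ) m = a (φ m)`. -/
noncomputable instance : Module Aᵐᵒᵖ (NakayamaModule k A M) where
  smul a ξ := LinearMap.comp (form ξ)
    (Module.toModuleEnd k (S := A) (M →ₗ[Aᵐᵒᵖ] A) a.unop)
  one_smul ξ := by
    refine LinearMap.ext fun φ => ?_
    exact congrArg (form ξ) (one_smul A φ)
  mul_smul a b ξ := by
    refine LinearMap.ext fun φ => ?_
    exact congrArg (form ξ) (mul_smul b.unop a.unop φ)
  smul_zero a := rfl
  smul_add a ξ η := rfl
  add_smul a b ξ := by
    refine LinearMap.ext fun φ => ?_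
    refine (congrArg (form ξ) (add_smul a.unop b.unop φ)).trans ?_
    exact map_add (form ξ) _ _
  zero_smul ξ := by
    refine LinearMap.ext fun φ => ?_
    refine (congrArg (form ξ) (zero_smul A φ)).trans ?_
    exact map_zero (form ξ)

instance : IsScalarTower k Aᵐᵒᵖ (NakayamaModule k A M) where
  smul_assoc c a ξ := by
    refine LinearMap.ext fun φ => ?_
    refine (congrArg (form ξ) (smul_assoc c a.unop φ)).trans ?_
    exact map_smul (form ξ) _ _

instance [Module.Finite k A] [Module.Finite Aᵐᵒᵖ M] : Module.Finite k (M →ₗ[Aᵐᵒᵖ] A) := by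
  obtain ⟨n, s, hs⟩ := Module.Finite.exists_fin (R := Aᵐᵒᵖ) (M := M)
  let ev : (M →ₗ[Aᵐᵒᵖ] A) →ₗ[k] (Fin n → A) :=
    { toFun := fun φ i => φ (s i)
      map_add' := fun _ _ => rfl
      map_smul' := fun _ _ => rfl }
  refine Module.Finite.of_injective ev (fun φ ψ h => ?_)
  refine LinearMap.ext_on hs ?_
  rintro _ ⟨i, rfl⟩
  exact congrFun h i

instance [Module.Finite k A] [Module.Finite Aᵐᵒᵖ M] :
    Module.Finite Aᵐᵒᵖ (NakayamaModule k A M) := by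
  have : Module.Finite k (NakayamaModule k A M) :=
    inferInstanceAs (Module.Finite k (Module.Dual k (M →ₗ[Aᵐᵒᵖ] A)))
  exact Module.Finite.of_restrictScalars_finite k Aᵐᵒᵖ _

/-- `D Hom_A(f, A)`, i.e. `ξ ↦ (φ ↦ ξ (φ ∘ f))`. -/
noncomputable def map (f : M →ₗ[Aᵐᵒᵖ] M') : NakayamaModule k A M →ₗ[Aᵐᵒᵖ] NakayamaModule k A M' where
  toFun ξ := LinearMap.comp (form ξ) (LinearMap.lcomp k A f)
  map_add' _ _ := rfl
  map_smul' _ _ := rfl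

end NakayamaModule

variable [Module.Finite k A]

/-- The Nakayama functor `D Hom_A(-, A)` on the category of finitely generated right modules over a
finite-dimensional `k`-algebra `A`. -/
noncomputable def nakayama : FGModuleCat.{u} Aᵐᵒᵖ ⥤ FGModuleCat.{u} Aᵐᵒᵖ where
  obj M := FGModuleCat.of Aᵐᵒᵖ (NakayamaModule k A M)
  map f := FGModuleCat.ofHom (NakayamaModule.map f.hom.hom)
  map_id _ := rfl
  map_comp _ _ := rfl

instance : (nakayama k A).Additive where
  map_add {M M' f g} := by
    apply FGModuleCat.hom_ext
    refine LinearMap.ext fun (ξ : NakayamaModule k A M) =>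
      LinearMap.ext fun (φ : M' →ₗ[Aᵐᵒᵖ] A) => ?_
    refine Eq.trans ?_ (map_add ξ.form
      (φ.comp f.hom.hom) (φ.comp g.hom.hom))
    refine congrArg ξ.form ?_
    exact LinearMap.comp_add _ _ _

end

section

variable (k : Type u) [Field k]

lemma isNoetherianRing_op (A : Type u) [Ring A] [Algebra k A] [Module.Finite k A] :
    IsNoetherianRing Aᵐᵒᵖ :=
  have : Module.Finite k Aᵐᵒᵖ := Module.Finite.equiv (MulOpposite.opLinearEquiv k)
  isNoetherian_of_tower k inferInstance

variable (n : ℕ)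

/-- The path algebra over `k` of the quiver `1 → 2 → ⋯ → n` (with vertices indexed by `Fin n`).
This quiver has exactly one path from `i` to `j` if `i ≤ j` and none otherwise, so an element of the
path algebra is a family of coefficients `a i j` with `a i j = 0` unless `i ≤ j`. The product is the
concatenation of paths, `(i → l) * (l → j) = (i → j)`, that is `(a * b) i j = ∑ l, a i l * b l j`.
A right module over it is a representation of the quiver. -/
abbrev PathAlgebra : Type u := IncidenceAlgebra k (Fin n)

instance : Module.Finite k (PathAlgebra k n) := by
  let f : PathAlgebra k n →ₗ[k] (Fin n → Fin n → k) :=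
    { toFun := fun a => a
      map_add' := fun _ _ => rfl
      map_smul' := fun _ _ => rfl }
  exact Module.Finite.of_injective f DFunLike.coe_injective

instance : IsNoetherianRing (PathAlgebra k n)ᵐᵒᵖ :=
  isNoetherianRing_op k (PathAlgebra k n)

/-- The category `𝒜_n` of finite-dimensional right modules over the path algebra of `1 → 2 → ⋯ → n`
(the finite-dimensional modules are the finitely generated ones, as the path algebra is
finite-dimensional). -/
abbrev ModA : Type (u+1) := FGModuleCat.{u} (PathAlgebra k n)ᵐᵒᵖ

/-- The families of scalars `(x i j)` with support in `{(i, j) | i ≥ j}`. -/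
def standardSubmodule : Submodule k (Fin n → Fin n → k) where
  carrier := {x | ∀ i j, ¬ j ≤ i → x i j = 0}
  add_mem' hx hy i j h := by simp [hx i j h, hy i j h]
  zero_mem' _ _ _ := rfl
  smul_mem' c x hx i j h := by simp [hx i j h]

/-- The standard bimodule `N_n` over the path algebra, with support `{(i, j) | i ≥ j}`: the vector space
at the vertex `(i, j)` is a copy of `k` if `i ≥ j` and zero otherwise, and an arrow acts by the
identity of `k` when both of its ends lie in the support (and by zero otherwise). -/
def StandardBimodule : Type u := standardSubmodule k n

namespace StandardBimodule

instance : AddCommGroup (StandardBimodule k n) := inferInstanceAs (AddCommGroup (standardSubmodule k n))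
instance : Module k (StandardBimodule k n) := inferInstanceAs (Module k (standardSubmodule k n))

variable {k n}

instance : CoeFun (StandardBimodule k n) (fun _ => Fin n → Fin n → k) := ⟨fun x => x.1⟩

lemma apply_eq_zero (x : StandardBimodule k n) {i j : Fin n} (h : ¬ j ≤ i) : x i j = 0 := x.2 i j h

@[ext]
lemma ext {x y : StandardBimodule k n} (h : ∀ i j, j ≤ i → x i j = y i j) : x = y := by
  refine Subtype.ext (funext₂ fun i j => ?_)
  by_cases hij : j ≤ i
  · exact h i j hij
  · exact (x.2 i j hij).trans (y.2 i j hij).symm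

@[simp] lemma add_apply (x y : StandardBimodule k n) (i j : Fin n) : (x + y) i j = x i j + y i j := rfl
@[simp] lemma zero_apply (i j : Fin n) : (0 : StandardBimodule k n) i j = 0 := rfl
@[simp] lemma smul_apply (c : k) (x : StandardBimodule k n) (i j : Fin n) : (c • x) i j = c * x i j := rfl

/-- The left action, contravariant in `i`: a path `i → l` maps the component `(l, j)` to the component
`(i, j)`, by the identity of `k` if `l ≥ j` and `i ≥ j`, and by zero otherwise. -/
instance : SMul (PathAlgebra k n) (StandardBimodule k n) where
  smul a x := ⟨fun i j => if j ≤ i then ∑ l, a i l * x l j else 0, fun _ _ h => if_neg h⟩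

/-- The right action, covariant in `j`: a path `l → j` maps the component `(i, l)` to the component
`(i, j)`, by the identity of `k` if `i ≥ l` and `i ≥ j`, and by zero otherwise. -/
instance : SMul (PathAlgebra k n)ᵐᵒᵖ (StandardBimodule k n) where
  smul a x := ⟨fun i j => if j ≤ i then ∑ l, x i l * a.unop l j else 0, fun _ _ h => if_neg h⟩

lemma left_apply (a : PathAlgebra k n) (x : StandardBimodule k n) {i j : Fin n} (h : j ≤ i) :
    (a • x) i j = ∑ l, a i l * x l j := if_pos h

lemma right_apply (a : (PathAlgebra k n)ᵐᵒᵖ) (x : StandardBimodule k n) {i j : Fin n} (h : j ≤ i) :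
    (a • x) i j = ∑ l, x i l * a.unop l j := if_pos h

lemma mul_apply' (a b : PathAlgebra k n) (i j : Fin n) : (a * b) i j = ∑ l, a i l * b l j := by
  rw [IncidenceAlgebra.mul_apply]
  refine Finset.sum_subset (Finset.subset_univ _) (fun l _ hl => ?_)
  rw [Finset.mem_Icc, not_and_or] at hl
  rcases hl with hl | hl
  · rw [IncidenceAlgebra.apply_eq_zero_of_not_le hl, zero_mul]
  · rw [IncidenceAlgebra.apply_eq_zero_of_not_le hl, mul_zero]

instance : Module (PathAlgebra k n) (StandardBimodule k n) where
  one_smul x := by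
    ext i j h
    rw [left_apply _ _ h]
    simp [IncidenceAlgebra.one_apply]
  mul_smul a b x := by
    ext i j h
    rw [left_apply _ _ h, left_apply _ _ h]
    have h₁ : ∀ l, a i l * (b • x) l j = ∑ m, a i l * (b l m * x m j) := by
      intro l
      by_cases hl : i ≤ l
      · rw [left_apply _ _ (h.trans hl), Finset.mul_sum]
      · simp [IncidenceAlgebra.apply_eq_zero_of_not_le hl]
    simp only [h₁, mul_apply', Finset.sum_mul]
    rw [Finset.sum_comm]
    simp only [mul_assoc]
  smul_zero a := by ext i j h; rw [left_apply _ _ h]; simp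
  smul_add a x y := by
    ext i j h
    rw [add_apply, left_apply _ _ h, left_apply _ _ h, left_apply _ _ h]
    simp [mul_add, Finset.sum_add_distrib]
  add_smul a b x := by
    ext i j h
    rw [add_apply, left_apply _ _ h, left_apply _ _ h, left_apply _ _ h]
    simp [add_mul, Finset.sum_add_distrib]
  zero_smul x := by ext i j h; rw [left_apply _ _ h]; simp

instance : Module (PathAlgebra k n)ᵐᵒᵖ (StandardBimodule k n) where
  one_smul x := by
    ext i j h
    rw [right_apply _ _ h]
    simp [IncidenceAlgebra.one_apply]
  mul_smul a b x := by
    ext i j h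
    rw [right_apply _ _ h, right_apply _ _ h]
    have h₁ : ∀ l, (b • x) i l * a.unop l j = ∑ m, x i m * b.unop m l * a.unop l j := by
      intro l
      by_cases hl : l ≤ j
      · rw [right_apply _ _ (hl.trans h), Finset.sum_mul]
      · simp [IncidenceAlgebra.apply_eq_zero_of_not_le hl]
    simp only [h₁, MulOpposite.unop_mul, mul_apply', Finset.mul_sum]
    rw [Finset.sum_comm]
    simp only [mul_assoc]
  smul_zero a := by ext i j h; rw [right_apply _ _ h]; simp
  smul_add a x y := by
    ext i j h
    rw [add_apply, right_apply _ _ h, right_apply _ _ h, right_apply _ _ h]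
    simp [add_mul, Finset.sum_add_distrib]
  add_smul a b x := by
    ext i j h
    rw [add_apply, right_apply _ _ h, right_apply _ _ h, right_apply _ _ h]
    simp [mul_add, Finset.sum_add_distrib]
  zero_smul x := by ext i j h; rw [right_apply _ _ h]; simp

instance : SMulCommClass (PathAlgebra k n) (PathAlgebra k n)ᵐᵒᵖ (StandardBimodule k n) where
  smul_comm a b x := by
    ext i j h
    rw [left_apply _ _ h, right_apply _ _ h]
    have h₁ : ∀ l, a i l * (b • x) l j = ∑ m, a i l * (x l m * b.unop m j) := by
      intro l
      by_cases hl : i ≤ l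
      · rw [right_apply _ _ (h.trans hl), Finset.mul_sum]
      · simp [IncidenceAlgebra.apply_eq_zero_of_not_le hl]
    have h₂ : ∀ m, (a • x) i m * b.unop m j = ∑ l, a i l * x l m * b.unop m j := by
      intro m
      by_cases hm : m ≤ j
      · rw [left_apply _ _ (hm.trans h), Finset.sum_mul]
      · simp [IncidenceAlgebra.apply_eq_zero_of_not_le hm]
    simp only [h₁, h₂]
    rw [Finset.sum_comm]
    simp only [mul_assoc]

instance : IsScalarTower k (PathAlgebra k n)ᵐᵒᵖ (StandardBimodule k n) where
  smul_assoc c a x := by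
    ext i j h
    rw [smul_apply, right_apply _ _ h, right_apply _ _ h, Finset.mul_sum]
    refine Finset.sum_congr rfl (fun l _ => ?_)
    change x i l * (c * a.unop l j) = _
    ring

instance : Module.Finite (PathAlgebra k n)ᵐᵒᵖ (StandardBimodule k n) :=
  have : Module.Finite k (StandardBimodule k n) :=
    inferInstanceAs (Module.Finite k (standardSubmodule k n))
  Module.Finite.of_restrictScalars_finite k (PathAlgebra k n)ᵐᵒᵖ _

end StandardBimodule
end

end TypeAQuiver

/-!
The standard bimodule `N` is the dual `DA` of the path algebra `A`: if `A` consists of the upper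
and `N` of the lower triangular matrices, then `(ν, a) ↦ tr (ν a)` is a perfect pairing, and both
actions on `N` are adjoint to multiplication in `A`. Hence `m ⊗ ν ↦ (φ ↦ ⟨ν, φ m⟩)` is an
isomorphism from `M ⊗_A N` to `D Hom_A(M, A)` for every finitely generated `M`: it is injective
since `D (M ⊗_A N) = Hom_A(M, DN) = Hom_A(M, A)`, and surjective since a form on `Hom_A(M, A)`
extends to a form on `A ^ r`, when `M` is generated by `r` elements. So the two functors are
isomorphic before being derived.

The derived functors exist since `A` is hereditary: every nonzero submodule of the module of row
vectors consists of the vectors vanishing before some index, and is a direct summand of `A`. In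
finite projective dimension every bounded complex has a bounded projective resolution `P`.
Morphisms out of `P` in the derived category are homotopy classes of chain maps, so a functor
applied to `P` computes the value of its derived functor.
-/

namespace BoundedDerived

open CategoryTheory Limits HomologicalComplex

section Extension

variable {C D H : Type*} [Category* C] [Category* D] [Category* H]

lemma hasPointwiseRightKanExtensionAt_obj (L : C ⥤ D) (F : C ⥤ H) (P : C)
    (hL : ∀ ⦃Y : C⦄ (f : L.obj P ⟶ L.obj Y), ∃ g : P ⟶ Y, L.map g = f)
    (hF : ∀ ⦃Y : C⦄ (g g' : P ⟶ Y), L.map g = L.map g' → F.map g = F.map g') :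
    L.HasPointwiseRightKanExtensionAt F (L.obj P) := by
  choose l hl using fun j : StructuredArrow (L.obj P) L => hL j.hom
  let c : Cone (StructuredArrow.proj (L.obj P) L ⋙ F) :=
    { pt := F.obj P
      π :=
        { app j := F.map (l j)
          naturality i j φ := by
            refine (Category.id_comp _).trans ((hF (l j) (l i ≫ φ.right) ?_).trans (F.map_comp _ _))
            rw [L.map_comp, hl, hl, StructuredArrow.w] } }
  let j₀ : StructuredArrow (L.obj P) L := StructuredArrow.mk (𝟙 (L.obj P))
  have map_l_j₀ : F.map (l j₀) = 𝟙 _ := by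
    rw [← F.map_id]
    exact hF _ _ ((hl j₀).trans (L.map_id P).symm)
  refine ⟨⟨⟨c, { lift s := s.π.app j₀, fac s j := ?_, uniq s m hm := ?_ }⟩⟩⟩
  · have h := s.π.naturality
      (StructuredArrow.homMk (l j) ((Category.id_comp _).trans (hl j)) : j₀ ⟶ j)
    exact (h.symm.trans (Category.id_comp _))
  · rw [← hm j₀]
    exact ((congrArg (m ≫ ·) map_l_j₀).trans (Category.comp_id _)).symm

end Extension

variable {C : Type*} [Category* C] [Abelian C]

section Resolution

lemma isKProjective_of_bounded {P : CochainComplex C ℤ} (hP : bounded C P)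
    (h : ∀ i, Projective (P.X i)) : P.IsKProjective := by
  obtain ⟨-, b, _⟩ := hP
  exact CochainComplex.isKProjective_of_projective P b

lemma bounded_of_isZero {K L : CochainComplex C ℤ} (hL : bounded C L)
    (h : ∀ i, IsZero (L.X i) → IsZero (K.X i)) : bounded C K := by
  obtain ⟨⟨a, _⟩, ⟨b, _⟩⟩ := hL
  exact ⟨⟨a, (CochainComplex.isStrictlyGE_iff _ _).2
      fun i hi => h i (L.isZero_of_isStrictlyGE a i hi)⟩,
    ⟨b, (CochainComplex.isStrictlyLE_iff _ _).2
      fun i hi => h i (L.isZero_of_isStrictlyLE b i hi)⟩⟩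

lemma bounded_mappingCone {K L : CochainComplex C ℤ} (f : K ⟶ L) (hK : bounded C K)
    (hL : bounded C L) : bounded C (CochainComplex.mappingCone f) := by
  obtain ⟨⟨a, _⟩, ⟨b, _⟩⟩ := hK
  obtain ⟨⟨a', _⟩, ⟨b', _⟩⟩ := hL
  exact ⟨⟨min (a - 1) a', CochainComplex.isStrictlyGE_mappingCone f a a' _ (by simp) (by simp)⟩,
    ⟨_, isStrictlyLE_mappingCone C f b b'⟩⟩

lemma projective_mappingCone_X {K L : CochainComplex C ℤ} (f : K ⟶ L)
    (hK : ∀ i, Projective (K.X i)) (hL : ∀ i, Projective (L.X i)) (i : ℤ) :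
    Projective ((CochainComplex.mappingCone f).X i) :=
  have := hK
  have := hL
  Projective.of_iso (homotopyCofiber.XIsoBiprod f i (i + 1) rfl).symm inferInstance

lemma quasiIso_mappingCone_map_id {K K' L : CochainComplex C ℤ} (p : K' ⟶ K) [QuasiIso p]
    (f : K ⟶ L) :
    QuasiIso (CochainComplex.mappingCone.map (p ≫ f) f p (𝟙 L) (Category.comp_id _)) := by
  let := HasDerivedCategory.standard C
  rw [← DerivedCategory.isIso_Q_map_iff_quasiIso]
  exact Pretriangulated.isIso₃_of_isIso₁₂
    (DerivedCategory.Q.mapTriangle.map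
      (CochainComplex.mappingCone.triangleMap (p ≫ f) f p (𝟙 L) (Category.comp_id _)))
    (DerivedCategory.mappingCone_triangle_distinguished _)
    (DerivedCategory.mappingCone_triangle_distinguished _)
    ((DerivedCategory.isIso_Q_map_iff_quasiIso C p).2 inferInstance)
    (inferInstanceAs (IsIso (DerivedCategory.Q.map (𝟙 L))))

lemma exists_projective_epi_of_isZero [EnoughProjectives C] (X : C) :
    ∃ (P : C) (p : P ⟶ X), Projective P ∧ Epi p ∧ (IsZero X → IsZero P) := by
  by_cases hX : IsZero X
  · exact ⟨X, 𝟙 X, Projective.of_iso hX.isoZero.symm inferInstance, inferInstance, id⟩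
  · exact ⟨_, Projective.π X, inferInstance, inferInstance, fun h => (hX h).elim⟩

lemma exists_bounded_projective_epi [EnoughProjectives C] {X : CochainComplex C ℤ}
    (hX : bounded C X) :
    ∃ (Z : CochainComplex C ℤ) (p : Z ⟶ X), bounded C Z ∧ (∀ i, Projective (Z.X i)) ∧ Epi p := by
  choose P p hP hp hP₀ using fun i => exists_projective_epi_of_isZero (X.X i)
  -- `Z` is the cone of the identity of the sum of the `P i` placed in degree `i + 1` with zero
  -- differential, so a chain map `Z ⟶ X` is the same as a family of morphisms `P i ⟶ X.X i`.
  let T : CochainComplex C ℤ := { X i := P (i - 1), d _ _ := 0 }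
  have hT : bounded C T := by
    obtain ⟨⟨a, _⟩, ⟨b, _⟩⟩ := hX
    exact ⟨⟨a + 1, (CochainComplex.isStrictlyGE_iff _ _).2
        fun i hi => hP₀ _ (X.isZero_of_isStrictlyGE a _ (by lia))⟩,
      ⟨b + 1, (CochainComplex.isStrictlyLE_iff _ _).2
        fun i hi => hP₀ _ (X.isZero_of_isStrictlyLE b _ (by lia))⟩⟩
  let α : CochainComplex.HomComplex.Cochain T X (-1) :=
    .mk fun i j hij => p (i - 1) ≫ (X.XIsoOfEq (by lia)).hom
  let β : CochainComplex.HomComplex.Cocycle T X 0 :=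
    .mk (CochainComplex.HomComplex.δ (-1) 0 α) 1 rfl (CochainComplex.HomComplex.δ_δ _ _ _ _)
  let π : CochainComplex.mappingCone (𝟙 T) ⟶ X :=
    CochainComplex.mappingCone.desc (𝟙 T) α β.homOf (by simp [β])
  have epi_π_f (i : ℤ) : Epi (π.f i) := by
    have h : (CochainComplex.mappingCone.inl (𝟙 T)).v (i + 1) i (by lia) ≫ π.f i =
        p (i + 1 - 1) ≫ (X.XIsoOfEq (by lia)).hom := by
      rw [CochainComplex.mappingCone.inl_v_desc_f]
      rfl
    have : Epi (p (i + 1 - 1)) := hp _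
    have : Epi ((CochainComplex.mappingCone.inl (𝟙 T)).v (i + 1) i (by lia) ≫ π.f i) := by
      rw [h]
      infer_instance
    exact epi_of_epi ((CochainComplex.mappingCone.inl (𝟙 T)).v (i + 1) i _) (π.f i)
  exact ⟨_, π, bounded_mappingCone _ hT hT,
    projective_mappingCone_X _ (fun i => hP _) (fun i => hP _), epi_of_epi_f _ epi_π_f⟩

theorem exists_bounded_projective_resolution [EnoughProjectives C] (d : ℕ)
    {X : CochainComplex C ℤ} (hX : bounded C X) (hd : ∀ i, HasProjectiveDimensionLE (X.X i) d) :
    ∃ (P : CochainComplex C ℤ) (p : P ⟶ X), bounded C P ∧ (∀ i, Projective (P.X i)) ∧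
      QuasiIso p := by
  induction d generalizing X with
  | zero =>
    exact ⟨X, 𝟙 X, hX, fun i => (projective_iff_hasProjectiveDimensionLE_zero _).2 (hd i),
      inferInstance⟩
  | succ d ih =>
    obtain ⟨Z, q, hZ, hZ', _⟩ := exists_bounded_projective_epi hX
    let S := ShortComplex.mk (kernel.ι q) q (kernel.condition q)
    have hS : S.ShortExact := { exact := S.exact_of_f_is_kernel (kernelIsKernel q) }
    have hK : bounded C (kernel q) :=
      bounded_of_isZero hZ fun i hi => hi.of_mono ((kernel.ι q).f i)
    have hKd (i : ℤ) : HasProjectiveDimensionLE ((kernel q).X i) d :=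
      ((hS.map_of_exact (eval C _ i)).hasProjectiveDimensionLT_X₃_iff d (hZ' i)).1 (hd i)
    obtain ⟨P, p, hP, hP', _⟩ := ih hK hKd
    have := quasiIso_mappingCone_map_id p (kernel.ι q)
    have := CochainComplex.mappingCone.quasiIso_descShortComplex hS
    exact ⟨_, CochainComplex.mappingCone.map (p ≫ kernel.ι q) (kernel.ι q) p (𝟙 Z) _ ≫
        CochainComplex.mappingCone.descShortComplex S,
      bounded_mappingCone _ hP hZ, projective_mappingCone_X _ hP' hZ', inferInstance⟩

end Resolution

variable [HasDerivedCategory.{w} C]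

lemma Q_map_eq_of_homotopy {K L : Complexes C} {f g : K ⟶ L} (h : _root_.Homotopy f.hom g.hom) :
    (Q C).map f = (Q C).map g := by
  ext
  exact DerivedCategory.Q_map_eq_of_homotopy _ h

section KProjective

variable {P Y : Complexes C} [P.obj.IsKProjective]

lemma Q_map_eq_iff_of_isKProjective (f g : P ⟶ Y) :
    (Q C).map f = (Q C).map g ↔ Nonempty (_root_.Homotopy f.hom g.hom) := by
  refine ⟨fun h => ⟨HomotopyCategory.homotopyOfEq _ _
    ((CochainComplex.IsKProjective.Qh_map_bijective P.obj _).1 ?_)⟩,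
    fun ⟨h⟩ => Q_map_eq_of_homotopy h⟩
  have h' : DerivedCategory.Q.map f.hom = DerivedCategory.Q.map g.hom := congrArg (·.hom) h
  have := congr(((DerivedCategory.quotientCompQhIso C).hom.app P.obj) ≫ $h')
  rw [← NatTrans.naturality, ← NatTrans.naturality] at this
  exact (cancel_mono _).1 this

lemma Q_map_surjective_of_isKProjective : Function.Surjective ((Q C).map : (P ⟶ Y) → _) := by
  intro f
  obtain ⟨f : DerivedCategory.Q.obj P.obj ⟶ DerivedCategory.Q.obj Y.obj, rfl⟩ :=
    ObjectProperty.homMk_surjective f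
  let e := DerivedCategory.quotientCompQhIso C
  obtain ⟨g, hg⟩ := (CochainComplex.IsKProjective.Qh_map_bijective P.obj _).2
    (e.hom.app P.obj ≫ f ≫ e.inv.app Y.obj)
  obtain ⟨g, rfl⟩ := (HomotopyCategory.quotient _ _).map_surjective g
  refine ⟨ObjectProperty.homMk g, ?_⟩
  ext
  refine (cancel_epi (e.hom.app P.obj)).1 ((e.hom.naturality g).symm.trans ?_)
  refine (congrArg (· ≫ e.hom.app Y.obj) hg).trans ?_
  simp only [Category.assoc, Iso.inv_hom_id_app, Category.comp_id]
  rfl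

end KProjective

section LeftDerived

variable {D : Type*} [Category* D] [Abelian D] [HasDerivedCategory.{w} D]

lemma hasPointwiseLeftDerivedFunctorAt_of_isKProjective (F : C ⥤ D) [F.Additive] (P : Complexes C)
    [P.obj.IsKProjective] :
    (mapComplexes F ⋙ Q D).HasPointwiseLeftDerivedFunctorAt (quasiIso C) P := by
  rw [Functor.hasPointwiseLeftDerivedFunctorAt_iff _ (Q C)]
  refine hasPointwiseRightKanExtensionAt_obj (Q C) _ P
    (fun Y f => Q_map_surjective_of_isKProjective f) fun Y f g h => ?_
  obtain ⟨h⟩ := (Q_map_eq_iff_of_isKProjective f g).1 h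
  exact Q_map_eq_of_homotopy (F.mapHomotopy h)

theorem hasLeftDerived_of_hasProjectiveDimensionLE [EnoughProjectives C] (d : ℕ)
    (hd : ∀ X : C, HasProjectiveDimensionLE X d) (F : C ⥤ D) [F.Additive] : HasLeftDerived F := by
  have : (mapComplexes F ⋙ Q D).HasPointwiseLeftDerivedFunctor (quasiIso C) := fun X => by
    obtain ⟨P, p, hP, hP', hp⟩ :=
      exists_bounded_projective_resolution d X.property fun i => hd (X.obj.X i)
    have := isKProjective_of_bounded hP hP'
    let P' : Complexes C := ⟨P, hP⟩
    have : P'.obj.IsKProjective := by assumption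
    rw [← Functor.hasPointwiseLeftDerivedFunctorAt_iff_of_mem _ _
      (ObjectProperty.homMk p : P' ⟶ X) hp]
    exact hasPointwiseLeftDerivedFunctorAt_of_isKProjective F P'
  infer_instance

/-- The isomorphism of functors `Cᵇ(C) ⥤ Cᵇ(D)` induced by an isomorphism of additive functors. -/
def mapComplexesIso {F G : C ⥤ D} [F.Additive] [G.Additive] (e : F ≅ G) :
    mapComplexes F ≅ mapComplexes G :=
  NatIso.ofComponents
    (fun K => (bounded D).isoMk ((NatIso.mapHomologicalComplex e _).app K.obj))
    (fun f => by ext : 1; exact (NatIso.mapHomologicalComplex e _).hom.naturality f.hom)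

/-- Isomorphic additive functors have isomorphic total left derived functors. -/
noncomputable def leftDerivedIso {F G : C ⥤ D} [F.Additive] [G.Additive] [HasLeftDerived F]
    [HasLeftDerived G] (e : F ≅ G) : leftDerived F ≅ leftDerived G :=
  Functor.leftDerivedNatIso ((mapComplexes F ⋙ Q D).totalLeftDerived (Q C) (quasiIso C))
    ((mapComplexes G ⋙ Q D).totalLeftDerived (Q C) (quasiIso C))
    ((mapComplexes F ⋙ Q D).totalLeftDerivedCounit (Q C) (quasiIso C))
    ((mapComplexes G ⋙ Q D).totalLeftDerivedCounit (Q C) (quasiIso C)) (quasiIso C)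
    (Functor.isoWhiskerRight (mapComplexesIso e) (Q D))

end LeftDerived

end BoundedDerived

/-- A module all of whose submodules are projective. A ring `R` is right hereditary when
`IsHereditaryModule Rᵐᵒᵖ Rᵐᵒᵖ` holds. -/
def IsHereditaryModule (R M : Type*) [Ring R] [AddCommGroup M] [Module R M] : Prop :=
  ∀ W : Submodule R M, Module.Projective R W

namespace IsHereditaryModule

variable {R M N : Type*} [Ring R] [AddCommGroup M] [Module R M] [AddCommGroup N] [Module R N]

lemma projective (hM : IsHereditaryModule R M) : Module.Projective R M :=
  have := hM ⊤
  .of_equiv Submodule.topEquiv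

lemma of_injective (hN : IsHereditaryModule R N) (f : M →ₗ[R] N) (hf : Function.Injective f) :
    IsHereditaryModule R M := fun W =>
  have := hN (W.map f)
  .of_equiv (W.equivMapOfInjective f hf).symm

lemma of_ker (g : M →ₗ[R] N) (hK : IsHereditaryModule R (LinearMap.ker g))
    (hN : IsHereditaryModule R N) : IsHereditaryModule R M := fun W => by
  let f : W →ₗ[R] N := g.domRestrict W
  have : Module.Projective R (LinearMap.range f) := hN _
  have : Module.Projective R (LinearMap.ker f) :=
    (hK.of_injective (W.subtype.restrict (p := LinearMap.ker f) (q := LinearMap.ker g)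
      fun _ hx => hx) fun _ _ h =>
        Subtype.ext (Subtype.ext (congrArg (fun z : LinearMap.ker g => z.1) h))).projective
  obtain ⟨s, hs⟩ := f.rangeRestrict.exists_rightInverse_of_surjective f.range_rangeRestrict
  exact .of_equiv (lequivProdOfRightSplitExact (LinearMap.ker f).injective_subtype
    ((LinearMap.ker f).range_subtype.trans f.ker_rangeRestrict.symm) hs)

lemma pi_fin (hM : IsHereditaryModule R M) : ∀ n : ℕ, IsHereditaryModule R (Fin n → M)
  | 0 => fun _ => inferInstance
  | n + 1 => of_ker (LinearMap.proj 0) ((pi_fin hM n).of_injective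
      ((LinearMap.funLeft R M Fin.succ).domRestrict _) fun x y h =>
        Subtype.ext (funext (Fin.cases (x.2.trans y.2.symm) (congrFun h)))) hM

end IsHereditaryModule

namespace TypeAQuiver

open CategoryTheory

section FGModuleCat

variable {R : Type u} [Ring R]

lemma epi_of_surjective {M N : FGModuleCat.{u} R} (f : M ⟶ N)
    (hf : Function.Surjective f.hom.hom) : Epi f :=
  (forget₂ (FGModuleCat.{u} R) (ModuleCat.{u} R)).epi_of_epi_map
    ((ModuleCat.epi_iff_surjective _).2 hf)

lemma exists_epi_of_free (M : FGModuleCat.{u} R) :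
    ∃ (n : ℕ) (f : FGModuleCat.of R (Fin n → R) ⟶ M), Epi f := by
  obtain ⟨n, f, hf⟩ := Module.Finite.exists_fin' R M
  exact ⟨n, FGModuleCat.ofHom f, epi_of_surjective _ hf⟩

variable [IsNoetherianRing R]

lemma surjective_of_epi {M N : FGModuleCat.{u} R} (f : M ⟶ N) [Epi f] :
    Function.Surjective f.hom.hom :=
  (ModuleCat.epi_iff_surjective ((forget₂ (FGModuleCat.{u} R) (ModuleCat.{u} R)).map f)).1
    inferInstance

lemma injective_of_mono {M N : FGModuleCat.{u} R} (f : M ⟶ N) [Mono f] :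
    Function.Injective f.hom.hom :=
  (ModuleCat.mono_iff_injective ((forget₂ (FGModuleCat.{u} R) (ModuleCat.{u} R)).map f)).1
    inferInstance

lemma projective_of_moduleProjective (P : FGModuleCat.{u} R) [Module.Projective R P] :
    Projective P where
  factors f e _ := by
    obtain ⟨g, hg⟩ := Module.projective_lifting_property e.hom.hom f.hom.hom (surjective_of_epi e)
    exact ⟨FGModuleCat.ofHom g, FGModuleCat.hom_ext hg⟩

instance (n : ℕ) : Projective (FGModuleCat.of R (Fin n → R)) :=
  have : Module.Projective R (FGModuleCat.of R (Fin n → R)) :=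
    inferInstanceAs (Module.Projective R (Fin n → R))
  projective_of_moduleProjective _

instance : EnoughProjectives (FGModuleCat.{u} R) where
  presentation M := by
    obtain ⟨n, f, hf⟩ := exists_epi_of_free M
    exact ⟨{ p := _, projective := inferInstance, f := f, epi := hf }⟩

lemma hasProjectiveDimensionLE_one (hR : IsHereditaryModule R R) (M : FGModuleCat.{u} R) :
    HasProjectiveDimensionLE M 1 := by
  obtain ⟨n, f, _⟩ := exists_epi_of_free M
  let S := ShortComplex.mk (Limits.kernel.ι f) f (Limits.kernel.condition f)
  have hS : S.ShortExact := { exact := S.exact_of_f_is_kernel (Limits.kernelIsKernel f) }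
  have := ((hR.pi_fin n).of_injective _ (injective_of_mono (Limits.kernel.ι f))).projective
  have : Projective S.X₁ := projective_of_moduleProjective (Limits.kernel f)
  exact (hS.hasProjectiveDimensionLT_X₃_iff 0 inferInstance).2 inferInstance

end FGModuleCat

namespace PathAlgebra

variable {k : Type u} [Field k] {n : ℕ}

variable (k n) in
/-- The path algebra of `1 → 2 → ⋯ → n`, as an algebra of upper triangular matrices. -/
def toMatrix : PathAlgebra k n →ₐ[k] Matrix (Fin n) (Fin n) k where
  toFun a := Matrix.of a
  map_one' := by
    ext i j
    exact IncidenceAlgebra.one_apply i j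
  map_mul' a b := Matrix.ext fun i j => StandardBimodule.mul_apply' a b i j
  map_zero' := rfl
  map_add' _ _ := rfl
  commutes' c := by
    ext i j
    simp [Algebra.algebraMap_eq_smul_one, Matrix.one_apply, IncidenceAlgebra.one_apply]

@[simp]
lemma toMatrix_apply (a : PathAlgebra k n) (i j : Fin n) : toMatrix k n a i j = a i j := rfl

lemma toMatrix_injective : Function.Injective (toMatrix k n) := fun _ _ h =>
  DFunLike.coe_injective h

end PathAlgebra

section Hereditary

variable (k : Type u) [Field k] (n : ℕ)

/-- The row vectors of length `n`, on which the path algebra of `1 → 2 → ⋯ → n` acts on the right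
as an algebra of matrices. -/
def RowModule : Type u := Fin n → k

namespace RowModule

instance : AddCommGroup (RowModule k n) := inferInstanceAs (AddCommGroup (Fin n → k))

open PathAlgebra Matrix

variable {k n}

instance : Module (PathAlgebra k n)ᵐᵒᵖ (RowModule k n) where
  smul a x := Matrix.vecMul x (toMatrix k n a.unop)
  one_smul x := (congrArg _ (map_one (toMatrix k n))).trans (vecMul_one x)
  mul_smul _ _ x := (congrArg _ (map_mul (toMatrix k n) _ _)).trans (vecMul_vecMul x _ _).symm
  smul_zero _ := zero_vecMul _
  smul_add _ x y := add_vecMul _ x y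
  add_smul _ _ x := vecMul_add _ _ x
  zero_smul x := vecMul_zero x

lemma smul_apply (a : (PathAlgebra k n)ᵐᵒᵖ) (x : RowModule k n) (j : Fin n) :
    (a • x) j = ∑ l, x l * a.unop l j := rfl

/-- The submodule of the row vectors whose entries before the `i`-th one vanish. It is the
indecomposable projective module at the vertex `i`. -/
def tail (i : Fin n) : Submodule (PathAlgebra k n)ᵐᵒᵖ (RowModule k n) where
  carrier := {x | ∀ j < i, x j = 0}
  add_mem' {x y} hx hy j hj := by
    change x j + y j = 0
    rw [hx j hj, hy j hj, add_zero]
  zero_mem' _ _ := rfl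
  smul_mem' a x hx j hj := by
    rw [smul_apply]
    refine Finset.sum_eq_zero fun l _ => ?_
    rcases lt_or_ge l i with hl | hl
    · rw [hx l hl, zero_mul]
    · rw [IncidenceAlgebra.apply_eq_zero_of_not_le (hj.trans_le hl).not_ge, mul_zero]

variable (k) in
/-- The `i`-th row of an element of the path algebra. -/
def row (i : Fin n) : (PathAlgebra k n)ᵐᵒᵖ →ₗ[(PathAlgebra k n)ᵐᵒᵖ] tail (k := k) i where
  toFun a := ⟨fun j => a.unop i j,
    fun _ hj => IncidenceAlgebra.apply_eq_zero_of_not_le hj.not_ge _⟩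
  map_add' _ _ := rfl
  map_smul' a b := Subtype.ext (funext fun j => StandardBimodule.mul_apply' b.unop a.unop i j)

/-- The element of the path algebra whose only nonzero row is the `i`-th one, equal to `x`. -/
def single (i : Fin n) : tail (k := k) i →ₗ[(PathAlgebra k n)ᵐᵒᵖ] (PathAlgebra k n)ᵐᵒᵖ where
  toFun x := MulOpposite.op
    { toFun l j := if l = i then x.1 j else 0
      eq_zero_of_not_le' l j h := by
        split_ifs with hl
        · exact x.2 j (hl ▸ not_le.1 h)
        · rfl }
  map_add' x y := by
    refine MulOpposite.unop_injective (toMatrix_injective (Matrix.ext fun l j => ?_))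
    change (if l = i then x.1 j + y.1 j else 0) =
      (if l = i then x.1 j else 0) + if l = i then y.1 j else 0
    split_ifs <;> simp
  map_smul' a x := by
    refine MulOpposite.unop_injective (toMatrix_injective (Matrix.ext fun l j => ?_))
    refine Eq.trans ?_ (StandardBimodule.mul_apply' _ a.unop l j).symm
    change (if l = i then ∑ m, x.1 m * a.unop m j else 0) =
      ∑ m, (if l = i then x.1 m else 0) * a.unop m j
    split_ifs <;> simp

lemma row_comp_single (i : Fin n) : row k i ∘ₗ single i = LinearMap.id :=
  LinearMap.ext fun _ => Subtype.ext (funext fun _ => if_pos rfl)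

lemma single_smul_apply {i : Fin n} (y : tail (k := k) i) (x : RowModule k n) (j : Fin n) :
    (single i y • x) j = x i * y.1 j := by
  change ∑ l, x l * (if l = i then y.1 j else 0) = x i * y.1 j
  simp

lemma projective_tail (i : Fin n) : Module.Projective (PathAlgebra k n)ᵐᵒᵖ (tail (k := k) i) :=
  .of_split (single i) (row k i) (row_comp_single i)

lemma tail_le {W : Submodule (PathAlgebra k n)ᵐᵒᵖ (RowModule k n)} {x : RowModule k n}
    (hx : x ∈ W) {i : Fin n} (hxi : x i ≠ 0) : tail i ≤ W := fun y hy => by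
  let z : tail (k := k) i := ⟨fun j => (x i)⁻¹ * y j, fun j hj =>
    (congrArg ((x i)⁻¹ * ·) (hy j hj)).trans (mul_zero _)⟩
  have : single i z • x = y := by
    funext j
    rw [single_smul_apply, mul_inv_cancel_left₀ hxi]
  exact this ▸ W.smul_mem _ hx

lemma exists_eq_tail {W : Submodule (PathAlgebra k n)ᵐᵒᵖ (RowModule k n)} (hW : W ≠ ⊥) :
    ∃ i, W = tail i := by
  have support_nonempty : {i | ∃ x ∈ W, x i ≠ 0}.Nonempty := by
    obtain ⟨x, hx, hx₀⟩ := W.ne_bot_iff.1 hW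
    obtain ⟨i, hi⟩ := Function.ne_iff.1 hx₀
    exact ⟨i, x, hx, hi⟩
  obtain ⟨i, ⟨x, hx, hxi⟩, hmin⟩ := wellFounded_lt.has_min _ support_nonempty
  refine ⟨i, le_antisymm (fun y hy j hj => ?_) (tail_le hx hxi)⟩
  by_contra h
  exact hmin j ⟨y, hy, h⟩ hj

lemma isHereditaryModule : IsHereditaryModule (PathAlgebra k n)ᵐᵒᵖ (RowModule k n) := fun W => by
  by_cases hW : W = ⊥
  · subst hW
    infer_instance
  · obtain ⟨i, rfl⟩ := exists_eq_tail hW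
    exact projective_tail i

end RowModule

lemma isHereditaryModule_pathAlgebra :
    IsHereditaryModule (PathAlgebra k n)ᵐᵒᵖ (PathAlgebra k n)ᵐᵒᵖ :=
  (RowModule.isHereditaryModule.pi_fin n).of_injective
    (LinearMap.pi fun i => (RowModule.tail i).subtype ∘ₗ RowModule.row k i)
    fun _ _ h => MulOpposite.unop_injective (DFunLike.coe_injective h)

end Hereditary

end TypeAQuiver

namespace TypeAQuiver

open CategoryTheory

section Pairing

variable {k : Type u} [Field k] {A : Type u} [Ring A] [Algebra k A]

section DualOfHom

variable {M V : Type u} [AddCommGroup M] [Module Aᵐᵒᵖ M] [AddCommGroup V] [Module k V]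

variable (k) in
/-- The evaluation at `m`, as a map `Hom_A(M, A) → A`. -/
def evalAt (m : M) : (M →ₗ[Aᵐᵒᵖ] A) →ₗ[k] A where
  toFun φ := φ m
  map_add' _ _ := rfl
  map_smul' _ _ := rfl

lemma exists_forall_eq_sum_pairing (p : V →ₗ[k] A →ₗ[k] k) [p.IsPerfPair] {n : ℕ} {s : Fin n → M}
    (hs : Submodule.span Aᵐᵒᵖ (Set.range s) = ⊤) (ξ : Module.Dual k (M →ₗ[Aᵐᵒᵖ] A)) :
    ∃ ν : Fin n → V, ∀ φ : M →ₗ[Aᵐᵒᵖ] A, ξ φ = ∑ i, p (ν i) (φ (s i)) := by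
  let ev : (M →ₗ[Aᵐᵒᵖ] A) →ₗ[k] (Fin n → A) := LinearMap.pi fun i => evalAt k (s i)
  have ker_ev : LinearMap.ker ev = ⊥ := LinearMap.ker_eq_bot.2 fun _ _ h =>
    LinearMap.ext_on_range hs (congrFun h)
  obtain ⟨g, hg⟩ := ev.exists_leftInverse_of_injective ker_ev
  choose ν hν using fun i => (LinearMap.IsPerfPair.bijective_left p).2
    (ξ ∘ₗ g ∘ₗ LinearMap.single k (fun _ => A) i)
  refine ⟨ν, fun φ => ?_⟩
  calc ξ φ = (ξ ∘ₗ g) (ev φ) := (congrArg ξ (LinearMap.congr_fun hg φ)).symm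
    _ = ∑ i, (ξ ∘ₗ g) (Pi.single i (φ (s i))) := by
      rw [← map_sum]
      exact congrArg _ (Finset.univ_sum_single (ev φ)).symm
    _ = ∑ i, p (ν i) (φ (s i)) :=
      Finset.sum_congr rfl fun i _ => (LinearMap.congr_fun (hν i) (φ (s i))).symm

end DualOfHom

variable {N : Type u} [AddCommGroup N] [Module k N] [Module A N] [Module Aᵐᵒᵖ N]

/-- A pairing between an `A`-bimodule `N` and the algebra `A` such that `ν ↦ ⟨ν, -⟩` is a morphism
of bimodules from `N` to the dual of `A`. If the pairing is perfect, it identifies `N` with this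
dual bimodule. -/
structure IsBimodulePairing (p : N →ₗ[k] A →ₗ[k] k) : Prop where
  smul (a : A) (ν : N) (b : A) : p (a • ν) b = p ν (b * a)
  op_smul (a : A) (ν : N) (b : A) : p (MulOpposite.op a • ν) b = p ν (a * b)

variable {p : N →ₗ[k] A →ₗ[k] k}

lemma IsBimodulePairing.isScalarTower (hp : IsBimodulePairing p) [p.IsPerfPair] :
    IsScalarTower k Aᵐᵒᵖ N where
  smul_assoc c a ν := (LinearMap.IsPerfPair.bijective_left p).1 <| LinearMap.ext fun b => by
    have : c • a = MulOpposite.op (c • a.unop) := rfl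
    rw [this, hp.op_smul, map_smul, LinearMap.smul_apply, ← MulOpposite.op_unop a, hp.op_smul,
      smul_mul_assoc, map_smul, MulOpposite.unop_op]

namespace BalancedTensor

variable {M M' : Type u} [AddCommGroup M] [Module Aᵐᵒᵖ M] [AddCommGroup M'] [Module Aᵐᵒᵖ M']

variable (M) in
/-- The map `M ⊗_A N → D Hom_A(M, A)` sending `m ⊗ ν` to `φ ↦ ⟨ν, φ m⟩`, attached to a pairing of
bimodules between `N` and `A`. -/
noncomputable def toNakayama (hp : IsBimodulePairing p) :
    BalancedTensor A M N →ₗ[Aᵐᵒᵖ] NakayamaModule k A M :=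
  Submodule.liftQ _
    (TensorProduct.AlgebraTensorModule.lift
      { toFun ν := (AddMonoidHom.mk' (fun m => show NakayamaModule k A M from p ν ∘ₗ evalAt k m)
          fun m m' => LinearMap.ext fun φ =>
            (congrArg (p ν) (map_add φ m m')).trans (map_add (p ν) _ _)).toIntLinearMap
        map_add' ν ν' := LinearMap.ext fun m => LinearMap.ext fun φ =>
          LinearMap.congr_fun (map_add p ν ν') (φ m)
        map_smul' a ν := LinearMap.ext fun m => LinearMap.ext fun φ => hp.op_smul a.unop ν (φ m) })
    (Submodule.span_le.2 <| by
      rintro _ ⟨m, a, ν, rfl⟩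
      rw [SetLike.mem_coe, LinearMap.mem_ker, map_sub, sub_eq_zero]
      refine LinearMap.ext fun φ => ?_
      exact (congrArg (p ν) (map_smul φ _ m)).trans (hp.smul a ν (φ m)).symm)

lemma toNakayama_tmul (hp : IsBimodulePairing p) (m : M) (ν : N) (φ : M →ₗ[Aᵐᵒᵖ] A) :
    (toNakayama M hp (tmul m ν)).form φ = p ν (φ m) := rfl

lemma toNakayama_comp_map (hp : IsBimodulePairing p) (f : M →ₗ[Aᵐᵒᵖ] M') :
    toNakayama M' hp ∘ₗ map N f = NakayamaModule.map f ∘ₗ toNakayama M hp :=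
  hom_ext fun _ _ => rfl

lemma toNakayama_surjective (hp : IsBimodulePairing p) [p.IsPerfPair] [Module.Finite Aᵐᵒᵖ M] :
    Function.Surjective (toNakayama M hp) := fun ξ => by
  obtain ⟨n, s, hs⟩ := Module.Finite.exists_fin (R := Aᵐᵒᵖ) (M := M)
  obtain ⟨ν, hν⟩ := exists_forall_eq_sum_pairing p hs ξ.form
  refine ⟨∑ i, tmul (s i) (ν i), LinearMap.ext fun φ => ?_⟩
  rw [map_sum]
  exact (LinearMap.sum_apply _ _ φ).trans (hν φ).symm

lemma exists_forall_form_toNakayama_eq [IsScalarTower k Aᵐᵒᵖ N] (hp : IsBimodulePairing p)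
    [p.IsPerfPair] (ℓ : Module.Dual k (BalancedTensor A M N)) :
    ∃ φ : M →ₗ[Aᵐᵒᵖ] A, ∀ x, (toNakayama M hp x).form φ = ℓ x := by
  have ext_right {a b : A} (h : ∀ ν, p ν a = p ν b) : a = b :=
    (LinearMap.IsPerfPair.bijective_right p).1 (LinearMap.ext h)
  choose φ hφ using fun m : M => (LinearMap.IsPerfPair.bijective_right p).2
    { toFun ν := ℓ (tmul m ν)
      map_add' ν ν' := by rw [tmul_add, map_add]
      map_smul' c ν := map_smul ℓ c (tmul m ν) }
  replace hφ (m : M) (ν : N) : p ν (φ m) = ℓ (tmul m ν) := LinearMap.congr_fun (hφ m) ν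
  let Φ : M →ₗ[Aᵐᵒᵖ] A :=
    { toFun := φ
      map_add' m m' := ext_right fun ν => by
        rw [map_add, hφ, hφ, hφ, add_tmul, map_add]
      map_smul' a m := ext_right fun ν => by
        change p ν _ = p ν (φ m * a.unop)
        rw [← hp.smul, hφ, hφ, ← op_smul_tmul, MulOpposite.op_unop] }
  refine ⟨Φ, fun x => ?_⟩
  obtain ⟨y, rfl⟩ := Submodule.Quotient.mk_surjective _ x
  induction y using TensorProduct.induction_on with
  | zero => exact (map_zero ℓ).symm
  | tmul ν m => exact (toNakayama_tmul hp m ν Φ).trans (hφ m ν)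
  | add y z hy hz =>
    rw [Submodule.Quotient.mk_add, map_add, map_add, ← hy, ← hz]
    rfl

lemma toNakayama_injective (hp : IsBimodulePairing p) [p.IsPerfPair] :
    Function.Injective (toNakayama M hp) := by
  have := hp.isScalarTower
  refine (injective_iff_map_eq_zero _).2 fun x hx => ?_
  refine (Module.forall_dual_apply_eq_zero_iff k x).1 fun ℓ => ?_
  obtain ⟨φ, hφ⟩ := exists_forall_form_toNakayama_eq hp ℓ
  rw [← hφ, hx]
  rfl

end BalancedTensor

/-- The isomorphism between `- ⊗_A N` and the Nakayama functor attached to a perfect pairing of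
bimodules between `N` and `A`. -/
noncomputable def tensorFunctorIsoNakayama [Module.Finite k A] [SMulCommClass A Aᵐᵒᵖ N]
    [Module.Finite Aᵐᵒᵖ N] (hp : IsBimodulePairing p) [p.IsPerfPair] :
    tensorFunctor A N ≅ nakayama k A :=
  NatIso.ofComponents
    (fun M => (LinearEquiv.ofBijective (BalancedTensor.toNakayama M hp)
      ⟨BalancedTensor.toNakayama_injective hp,
        BalancedTensor.toNakayama_surjective hp⟩).toFGModuleCatIso)
    fun f => FGModuleCat.hom_ext (BalancedTensor.toNakayama_comp_map hp f.hom.hom)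

end Pairing

section Trace

open Matrix

variable {k : Type u} [Field k] {n : ℕ}

namespace PathAlgebra

lemma trace_mul_toMatrix_congr {X Y : Matrix (Fin n) (Fin n) k} (h : ∀ i j, j ≤ i → X i j = Y i j)
    (a : PathAlgebra k n) :
    trace (X * toMatrix k n a) = trace (Y * toMatrix k n a) := by
  simp only [trace, diag_apply, Matrix.mul_apply]
  refine Finset.sum_congr rfl fun i _ => Finset.sum_congr rfl fun j _ => ?_
  by_cases hij : j ≤ i
  · rw [h i j hij]
  · rw [toMatrix_apply, IncidenceAlgebra.apply_eq_zero_of_not_le hij, mul_zero,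
      mul_zero]

/-- The path `i → j`, as an element of the path algebra. -/
def path {i j : Fin n} (h : i ≤ j) : PathAlgebra k n where
  toFun := Matrix.single i j 1
  eq_zero_of_not_le' _ _ hlm := single_apply_of_ne _ _ _ _ _ (by
    rintro ⟨rfl, rfl⟩
    exact hlm h)

end PathAlgebra

namespace StandardBimodule

variable (k n) in
/-- The inclusion of the standard bimodule in the space of matrices. Its image consists of the lower
triangular matrices, and the actions of the path algebra are given by the product of matrices
followed by the projection onto this image. -/
def toMatrix : StandardBimodule k n →ₗ[k] Matrix (Fin n) (Fin n) k where
  toFun ν := Matrix.of ν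
  map_add' _ _ := rfl
  map_smul' _ _ := rfl

variable (k n) in
/-- The trace pairing `(ν, a) ↦ tr (ν a)` between the standard bimodule and the path algebra. -/
def pairing : StandardBimodule k n →ₗ[k] PathAlgebra k n →ₗ[k] k :=
  ((LinearMap.mul k (Matrix (Fin n) (Fin n) k)).compr₂ (traceLinearMap (Fin n) k k)).compl₁₂
    (toMatrix k n) (PathAlgebra.toMatrix k n).toLinearMap

lemma pairing_apply (ν : StandardBimodule k n) (a : PathAlgebra k n) :
    pairing k n ν a = trace (toMatrix k n ν * PathAlgebra.toMatrix k n a) := rfl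

lemma isBimodulePairing_pairing : IsBimodulePairing (pairing k n) where
  smul a ν b := calc
    pairing k n (a • ν) b
      = trace (PathAlgebra.toMatrix k n a * toMatrix k n ν * PathAlgebra.toMatrix k n b) :=
        PathAlgebra.trace_mul_toMatrix_congr (fun _ _ => left_apply a ν) b
    _ = pairing k n ν (b * a) := by
        rw [pairing_apply, map_mul, Matrix.mul_assoc, trace_mul_comm, Matrix.mul_assoc]
  op_smul a ν b := calc
    pairing k n (MulOpposite.op a • ν) b
      = trace (toMatrix k n ν * PathAlgebra.toMatrix k n a * PathAlgebra.toMatrix k n b) :=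
        PathAlgebra.trace_mul_toMatrix_congr (fun _ _ => right_apply (MulOpposite.op a) ν) b
    _ = pairing k n ν (a * b) := by
        rw [pairing_apply, map_mul, Matrix.mul_assoc]

/-- The basis vector of the standard bimodule at the vertex `(i, j)`. -/
def unit {i j : Fin n} (h : j ≤ i) : StandardBimodule k n :=
  ⟨Matrix.single i j 1, fun _ _ hlm => single_apply_of_ne _ _ _ _ _ (by
    rintro ⟨rfl, rfl⟩
    exact hlm h)⟩

lemma pairing_path (ν : StandardBimodule k n) {i j : Fin n} (h : i ≤ j) :
    pairing k n ν (PathAlgebra.path h) = ν j i :=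
  (trace_mul_single (toMatrix k n ν) i j 1).trans (mul_one _)

lemma pairing_unit (a : PathAlgebra k n) {i j : Fin n} (h : j ≤ i) :
    pairing k n (unit h) a = a j i :=
  (trace_single_mul i j 1 (PathAlgebra.toMatrix k n a)).trans (one_mul _)

lemma pairing_injective : Function.Injective (pairing k n) := fun ν ν' h => by
  ext i j hij
  rw [← pairing_path ν hij, h, pairing_path]

lemma pairing_flip_injective : Function.Injective (pairing k n).flip := fun a b h => by
  ext i j hij
  rw [← pairing_unit a hij, ← pairing_unit b hij]
  exact LinearMap.congr_fun h _

instance : Module.Finite k (StandardBimodule k n) :=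
  inferInstanceAs (Module.Finite k (standardSubmodule k n))

instance : (pairing k n).IsPerfPair :=
  .of_injective pairing_injective pairing_flip_injective

end StandardBimodule

end Trace

end TypeAQuiver

theorem mainTheorem8_general (k : Type u) [Field k] (A : Type u) [Ring A] [Algebra k A]
    [Module.Finite k A] [IsNoetherianRing Aᵐᵒᵖ]
    [HasDerivedCategory.{w} (FGModuleCat.{u} Aᵐᵒᵖ)] (d : ℕ)
    (hd : ∀ M : FGModuleCat.{u} Aᵐᵒᵖ, CategoryTheory.HasProjectiveDimensionLE M d)
    (N : Type u) [AddCommGroup N] [Module k N] [Module A N] [Module Aᵐᵒᵖ N]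
    [SMulCommClass A Aᵐᵒᵖ N] [Module.Finite Aᵐᵒᵖ N] (p : N →ₗ[k] A →ₗ[k] k) [p.IsPerfPair]
    (hp : TypeAQuiver.IsBimodulePairing p) :
    ∃ (_ : BoundedDerived.HasLeftDerived (TypeAQuiver.nakayama k A))
      (_ : BoundedDerived.HasLeftDerived (TypeAQuiver.tensorFunctor A N)),
      Nonempty (CategoryTheory.Iso (BoundedDerived.leftDerived (TypeAQuiver.nakayama k A))
        (BoundedDerived.leftDerived (TypeAQuiver.tensorFunctor A N))) := by
  have nakayama_derived := BoundedDerived.hasLeftDerived_of_hasProjectiveDimensionLE d hd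
    (TypeAQuiver.nakayama k A)
  have tensor_derived := BoundedDerived.hasLeftDerived_of_hasProjectiveDimensionLE d hd
    (TypeAQuiver.tensorFunctor A N)
  exact ⟨nakayama_derived, tensor_derived,
    ⟨BoundedDerived.leftDerivedIso (TypeAQuiver.tensorFunctorIsoNakayama hp).symm⟩⟩

theorem mainTheorem8 (k : Type u) [Field k] (n : ℕ) (hn : 1 ≤ n)
    [HasDerivedCategory.{w} (TypeAQuiver.ModA k n)] :
    ∃ (_ : BoundedDerived.HasLeftDerived
          (TypeAQuiver.nakayama k (TypeAQuiver.PathAlgebra k n)))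
      (_ : BoundedDerived.HasLeftDerived
          (TypeAQuiver.tensorFunctor (TypeAQuiver.PathAlgebra k n)
            (TypeAQuiver.StandardBimodule k n))),
      Nonempty (CategoryTheory.Iso
        (BoundedDerived.leftDerived (TypeAQuiver.nakayama k (TypeAQuiver.PathAlgebra k n)))
        (BoundedDerived.leftDerived
          (TypeAQuiver.tensorFunctor (TypeAQuiver.PathAlgebra k n)
            (TypeAQuiver.StandardBimodule k n)))) :=
  mainTheorem8_general k _ 1 (TypeAQuiver.hasProjectiveDimensionLE_one
    (TypeAQuiver.isHereditaryModule_pathAlgebra k n)) _ (TypeAQuiver.StandardBimodule.pairing k n)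
    TypeAQuiver.StandardBimodule.isBimodulePairing_pairing
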